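/- Let $(U_y)_{y\in\mathbb Z}$ and $(V_x)_{x\in\mathbb Z}$ be random variables with values in $\{-1,1\}$, defined on one probability space, all of them jointly independent and each symmetric, i.e. $P(U_y=1)=P(U_y=-1)=\tfrac12$ and $P(V_x=1)=P(V_x=-1)=\tfrac12$. Think of $U_y$ as the orientation of the horizontal line at height $y$ and of $V_x$ as the orientation of the vertical line at abscissa $x$ in $\mathbb Z^2$. Let $Z_n=(X_n,Y_n)$, $n\ge 0$, be the path in $\mathbb Z^2$ given by $Z_0=(0,0)$ and $$Z_{n+1}=Z_n+(U_{Y_n},V_{X_n})\qquad (n\ge 0).$$ Then, almost surely, the path $Z$ eventually gets stuck on one edge, i.e. it is eventually 2-periodic: there are two points $a,b\in\mathbb Z^2$ whose coordinates both differ by exactly $1$, and an $N\ge 0$, such that $\{Z_n,Z_{n+1}\}=\{a,b\}$ and $Z_{n+2}=Z_n$ for all $n\ge N$. -/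

import Mathlib

open MeasureTheory ProbabilityTheory

/-- The diagonal walk on `ℤ²` started at the origin, in the environment where the horizontal line
at height `y` has orientation `u y` and the vertical line at abscissa `x` has orientation `v x`:
from `(x, y)` it moves to `(x + u y, y + v x)`. -/
def diagonalWalk (u v : ℤ → ℤ) : ℕ → ℤ × ℤ
  | 0 => (0, 0)
  | n + 1 =>
    let z := diagonalWalk u v n
    (z.1 + u z.2, z.2 + v z.1)

/-- `a` and `b` are joined by a diagonal edge, that is, they are opposite corners of a face of the
square lattice `ℤ²`. -/
def IsDiagonalEdge (a b : ℤ × ℤ) : Prop :=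
  |a.1 - b.1| = 1 ∧ |a.2 - b.2| = 1

/-- From some time on, every step of the path `z` runs along one and the same (unoriented) diagonal
edge. -/
def EventuallyStuckOnEdge (z : ℕ → ℤ × ℤ) : Prop :=
  ∃ a b : ℤ × ℤ, IsDiagonalEdge a b ∧ ∃ N : ℕ, ∀ n ≥ N, s(z n, z (n + 1)) = s(a, b)

/-- From some time on, the path `z` is periodic with period `2`. -/
def EventuallyTwoPeriodic (z : ℕ → ℤ × ℤ) : Prop :=
  ∃ N : ℕ, ∀ n ≥ N, z (n + 2) = z n

/-!
The path is a.s. bounded, hence eventually periodic, and a periodic orbit has period two.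

*Cycles have length two.* Let `z` be a periodic orbit of minimal period `n ≥ 3`, and let
`a k = u (z k).2`, `b k = v (z k).1` be the coordinates of its `k`-th step. The turn made between
the steps `k` and `k + 1`, counted in eighths of a full turn, is `a k * b (k + 1) - b k * a (k + 1)`.
If `G (x + 1) - G x = v x + v (x + 1)` and `H (y + 1) - H y = u y + u (y + 1)`, this is exactly the
increment of `G x - H y` along the step `k`, so the total turning over a period vanishes
(`diagonalAngle_sub_eq_zero`). On the other hand `z` is a simple closed polygon, whose total turning
is an odd multiple of a full turn (`diagonalAngle_sub_ne_zero`). The latter is a discrete form of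
Hopf's proof of the Umlaufsatz: the direction of the secant `z j - z i` is lifted to an integer
`secantAngle z i j` on `i < j < i + n`; since the secant from `j` to `i + n` is opposite to the one
from `i` to `j`, the difference of their angles is a constant half-turn modulo full turns, and the
total turning is twice that constant.

*The path is bounded.* By the symmetries of the environment, an upper bound for the abscissa
suffices. When the path first visits a column `M > 0` it came from column `M - 1`, and the
orientation `V M` is still fresh. If moreover the row on which it arrives points left
(`TurnsBackAt`), then with probability one half `V M = -V (M - 1)`, and the path is trapped on the
edge just traversed, never to go beyond column `M`. Hence the trapping events for distinct `M` are
disjoint, their probabilities sum to at most one, those of `TurnsBackAt` to at most two, and by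
Borel-Cantelli `TurnsBackAt` a.s. fails for all large `M` (`ae_eventually_not_turnsBackAt`). If the
abscissa were unbounded, the path would from some time on move right at every step, its ordinate
following the partial sums of `V` while avoiding every row that points left. Such rows exist above
and below, and arbitrarily long runs of `V = 1` push the ordinate across one of them
(`exists_fst_le_of_eventually_not_turnsBackAt`).
-/

/-! ### Directions and turns -/

/-- One step of the walk, as a map of `ℤ²`. -/
def walkStep (u v : ℤ → ℤ) (z : ℤ × ℤ) : ℤ × ℤ := (z.1 + u z.2, z.2 + v z.1)

/-- The sector of a nonzero vector: the four half-axes and the four open quadrants are numbered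
`0, …, 7` counterclockwise, starting from the positive horizontal half-axis. The value at `0` is
junk. -/
def sector (p : ℤ × ℤ) : ℤ :=
  if 0 < p.1 then (if p.2 < 0 then 7 else if p.2 = 0 then 0 else 1)
  else if p.1 = 0 then (if p.2 < 0 then 6 else 2)
  else (if p.2 < 0 then 5 else if p.2 = 0 then 4 else 3)

/-- The counterclockwise turn from `p` to `q` in eighths of a full turn: the representative in
`[-4, 4)` of the difference of their sectors modulo `8`. -/
def turn (p q : ℤ × ℤ) : ℤ := (sector q - sector p).bmod 8

lemma dvd_turn (p q : ℤ × ℤ) : 8 ∣ turn p q - (sector q - sector p) := by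
  rw [turn, Int.bmod_def]
  split_ifs <;> omega

lemma eight_dvd_sector_neg {p : ℤ × ℤ} (hp : p ≠ 0) : 8 ∣ sector (-p) - sector p - 4 := by
  obtain ⟨x, y⟩ := p
  have : x ≠ 0 ∨ y ≠ 0 := by
    by_contra h; push Not at h; exact hp (by ext <;> simp [h.1, h.2])
  simp only [sector, Prod.fst_neg, Prod.snd_neg]
  split_ifs <;> omega

lemma turn_neg {p q : ℤ × ℤ} (hp : p ≠ 0) (hq : q ≠ 0) : turn (-p) (-q) = turn p q := by
  unfold turn
  have h1 := eight_dvd_sector_neg hp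
  have h2 := eight_dvd_sector_neg hq
  rw [Int.bmod_def, Int.bmod_def]
  push_cast
  split_ifs <;> omega

/-- A diagonal step cannot jump over a sector: on the sublattice of even coordinate sum it neither
crosses a half-axis nor leads from one half-axis to another. -/
lemma abs_turn_le_one {p q : ℤ × ℤ} (hp : p ≠ 0) (hq : q ≠ 0) (he : Even (p.1 + p.2))
    (h1 : |q.1 - p.1| = 1) (h2 : |q.2 - p.2| = 1) : |turn p q| ≤ 1 := by
  obtain ⟨x, y⟩ := p
  obtain ⟨x', y'⟩ := q
  have hp' : x ≠ 0 ∨ y ≠ 0 := by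
    by_contra h; push Not at h; exact hp (by ext <;> simp [h.1, h.2])
  have hq' : x' ≠ 0 ∨ y' ≠ 0 := by
    by_contra h; push Not at h; exact hq (by ext <;> simp [h.1, h.2])
  obtain ⟨r, hr⟩ := he
  simp only at hr h1 h2
  rw [abs_eq one_pos.le] at h1 h2
  unfold turn sector
  rw [abs_le, Int.bmod_def]
  push_cast
  split_ifs <;> first | (exfalso; omega) | norm_num

/-- Small turns add up to zero around a square: their total is a multiple of `8` of absolute value
at most `4`. -/
lemma turn_square {p q q' r : ℤ × ℤ} (h1 : |turn p q| ≤ 1) (h2 : |turn q r| ≤ 1)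
    (h3 : |turn p q'| ≤ 1) (h4 : |turn q' r| ≤ 1) :
    turn p q + turn q r = turn p q' + turn q' r := by
  have := dvd_turn p q
  have := dvd_turn q r
  have := dvd_turn p q'
  have := dvd_turn q' r
  rw [abs_le] at *
  omega

/-- The turn between two consecutive steps that are not opposite, decomposed through the secant
spanning both, is the cross product of the steps. -/
lemma turn_corner {a b a' b' : ℤ} (ha : a = 1 ∨ a = -1) (hb : b = 1 ∨ b = -1)
    (ha' : a' = 1 ∨ a' = -1) (hb' : b' = 1 ∨ b' = -1) (h : (a + a', b + b') ≠ ((0, 0) : ℤ × ℤ)) :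
    turn (a, b) (a + a', b + b') + turn (a + a', b + b') (a', b') = a * b' - b * a' := by
  rcases ha with rfl | rfl <;> rcases hb with rfl | rfl <;> rcases ha' with rfl | rfl <;>
    rcases hb' with rfl | rfl <;> first | decide | exact absurd rfl h

lemma exists_antidifference (f : ℤ → ℤ) : ∃ G : ℤ → ℤ, ∀ x, G (x + 1) - G x = f x := by
  refine ⟨fun x => ∑ i ∈ Finset.Ico 0 x, f i - ∑ i ∈ Finset.Ico x 0, f i, fun x => ?_⟩
  rcases le_or_gt 0 x with hx | hx
  · have h1 : Finset.Ico x 0 = ∅ := Finset.Ico_eq_empty (by omega)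
    have h2 : Finset.Ico (x + 1) 0 = ∅ := Finset.Ico_eq_empty (by omega)
    have h3 : Finset.Ico 0 (x + 1) = insert x (Finset.Ico 0 x) := by ext; simp; omega
    simp [h1, h2, h3]
  · have h1 : Finset.Ico 0 x = ∅ := Finset.Ico_eq_empty (by omega)
    have h2 : Finset.Ico 0 (x + 1) = ∅ := Finset.Ico_eq_empty (by omega)
    have h3 : Finset.Ico x 0 = insert x (Finset.Ico (x + 1) 0) := by ext; simp; omega
    simp [h1, h2, h3]

/-! ### Total turning of a simple cycle -/

/-- A lift to `ℤ` of the sector of the `k`-th step `z (k + 1) - z k`, continued from each step to the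
next through the secant `z (k + 2) - z k`. -/
def diagonalAngle (z : ℕ → ℤ × ℤ) : ℕ → ℤ
  | 0 => sector (z 1 - z 0)
  | k + 1 => diagonalAngle z k + turn (z (k + 1) - z k) (z (k + 2) - z k) +
      turn (z (k + 2) - z k) (z (k + 2) - z (k + 1))

/-- A lift to `ℤ` of the sector of the secant `z j - z i`, for `i < j`: the endpoint `j` is moved one
step at a time, starting from `i + 1`. -/
def secantAngle (z : ℕ → ℤ × ℤ) (i j : ℕ) : ℤ :=
  diagonalAngle z i + ∑ k ∈ Finset.Ico (i + 1) j, turn (z k - z i) (z (k + 1) - z i)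

lemma secantAngle_self_succ (z : ℕ → ℤ × ℤ) (i : ℕ) :
    secantAngle z i (i + 1) = diagonalAngle z i := by simp [secantAngle]

lemma secantAngle_succ_right (z : ℕ → ℤ × ℤ) {i j : ℕ} (h : i < j) :
    secantAngle z i (j + 1) = secantAngle z i j + turn (z j - z i) (z (j + 1) - z i) := by
  rw [secantAngle, secantAngle, Finset.sum_Ico_succ_top (by omega)]; ring

lemma eight_dvd_secantAngle_sub (z : ℕ → ℤ × ℤ) {i j : ℕ} (h : i < j) :
    8 ∣ secantAngle z i j - sector (z j - z i) := by
  induction j, h using Nat.le_induction with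
  | base =>
    rw [secantAngle_self_succ]
    induction i with
    | zero => simp [diagonalAngle]
    | succ k ih =>
      have h1 := dvd_turn (z (k + 1) - z k) (z (k + 2) - z k)
      have h2 := dvd_turn (z (k + 2) - z k) (z (k + 2) - z (k + 1))
      rw [diagonalAngle]
      simp only [Nat.succ_eq_add_one] at *
      rw [show k + 1 + 1 = k + 2 from rfl]
      omega
  | succ j hj ih =>
    have h1 := dvd_turn (z j - z i) (z (j + 1) - z i)
    rw [secantAngle_succ_right z hj]
    omega

section Cycle

variable {z : ℕ → ℤ × ℤ} {n : ℕ}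

/-- The walk stays on the sublattice of the points whose coordinates have an even sum. -/
lemma even_secant (hstep : ∀ k, |(z (k + 1)).1 - (z k).1| = 1 ∧ |(z (k + 1)).2 - (z k).2| = 1)
    {i j : ℕ} (h : i ≤ j) : Even ((z j - z i).1 + (z j - z i).2) := by
  induction j, h using Nat.le_induction with
  | base => simp
  | succ j hj ih =>
    obtain ⟨h1, h2⟩ := hstep j
    obtain ⟨r, hr⟩ := ih
    rw [abs_eq one_pos.le] at h1 h2
    simp only [Prod.fst_sub, Prod.snd_sub] at *
    rw [Int.even_iff]
    omega

lemma abs_turn_right (hstep : ∀ k, |(z (k + 1)).1 - (z k).1| = 1 ∧ |(z (k + 1)).2 - (z k).2| = 1)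
    (hinj : ∀ i j, i < j → j < i + n → z i ≠ z j) {i j : ℕ} (h1 : i < j) (h2 : j + 1 < i + n) :
    |turn (z j - z i) (z (j + 1) - z i)| ≤ 1 := by
  refine abs_turn_le_one (sub_ne_zero.2 (hinj i j h1 (by omega)).symm)
    (sub_ne_zero.2 (hinj i (j + 1) (by omega) (by omega)).symm) (even_secant hstep h1.le) ?_ ?_
  · simpa using (hstep j).1
  · simpa using (hstep j).2

lemma abs_turn_left (hstep : ∀ k, |(z (k + 1)).1 - (z k).1| = 1 ∧ |(z (k + 1)).2 - (z k).2| = 1)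
    (hinj : ∀ i j, i < j → j < i + n → z i ≠ z j) {i j : ℕ} (h1 : i + 1 < j) (h2 : j < i + n) :
    |turn (z j - z i) (z j - z (i + 1))| ≤ 1 := by
  refine abs_turn_le_one (sub_ne_zero.2 (hinj i j (by omega) (by omega)).symm)
    (sub_ne_zero.2 (hinj (i + 1) j (by omega) (by omega)).symm) (even_secant hstep (by omega)) ?_ ?_
  · rw [abs_sub_comm]; simpa using (hstep i).1
  · rw [abs_sub_comm]; simpa using (hstep i).2

/-- The lift does not depend on the path along which the secant is moved: its variation in the
first endpoint is the turn of the secant as well. -/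
lemma secantAngle_succ_left
    (hstep : ∀ k, |(z (k + 1)).1 - (z k).1| = 1 ∧ |(z (k + 1)).2 - (z k).2| = 1)
    (hinj : ∀ i j, i < j → j < i + n → z i ≠ z j) {i j : ℕ} (h1 : i + 1 < j) (h2 : j < i + n) :
    secantAngle z (i + 1) j = secantAngle z i j + turn (z j - z i) (z j - z (i + 1)) := by
  induction j, h1 using Nat.le_induction with
  | base =>
    rw [Nat.succ_eq_add_one, secantAngle_self_succ, secantAngle_succ_right z (by omega),
      secantAngle_self_succ, diagonalAngle]
  | succ j hj ih =>
    have hj' : i + 1 < j := hj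
    rw [secantAngle_succ_right z hj', secantAngle_succ_right z (by omega : i < j), ih (by omega)]
    have := turn_square (abs_turn_right hstep hinj (by omega) h2)
      (abs_turn_left hstep hinj (by omega) h2)
      (abs_turn_left hstep hinj hj' (by omega))
      (abs_turn_right hstep hinj hj' (by omega))
    linarith

/-- Discrete Umlaufsatz: the total turning along a cycle without repeated points is not zero. -/
lemma diagonalAngle_sub_ne_zero
    (hstep : ∀ k, |(z (k + 1)).1 - (z k).1| = 1 ∧ |(z (k + 1)).2 - (z k).2| = 1)
    (hinj : ∀ i j, i < j → j < i + n → z i ≠ z j) (hper : ∀ k, z (k + n) = z k) (hn : 3 ≤ n) :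
    diagonalAngle z n - diagonalAngle z 0 ≠ 0 := by
  have hne : ∀ {i j : ℕ}, i < j → j < i + n → z j - z i ≠ 0 := fun h1 h2 =>
    sub_ne_zero.2 (hinj _ _ h1 h2).symm
  have hneg : ∀ i j, z (i + n) - z j = -(z j - z i) := fun i j => by rw [hper]; abel
  -- `secantAngle z j (i + n) - secantAngle z i j` compares two opposite secants; it does not change
  -- when `j` or `i` increases, as long as neither secant vanishes.
  have hright : ∀ i j, i < j → j + 1 < i + n →
      secantAngle z (j + 1) (i + n) - secantAngle z i (j + 1) =
        secantAngle z j (i + n) - secantAngle z i j := by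
    intro i j h1 h2
    rw [secantAngle_succ_left hstep hinj h2 (by omega), secantAngle_succ_right z h1, hneg, hneg,
      turn_neg (hne h1 (by omega)) (hne (by omega) (by omega))]
    ring
  have hleft : ∀ i j, i + 1 < j → j < i + n →
      secantAngle z j (i + n + 1) - secantAngle z (i + 1) j =
        secantAngle z j (i + n) - secantAngle z i j := by
    intro i j h1 h2
    rw [secantAngle_succ_left hstep hinj h1 h2, secantAngle_succ_right z h2, hneg,
      show i + n + 1 = i + 1 + n by ring, hneg,
      turn_neg (hne (by omega) (by omega)) (hne (by omega) (by omega))]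
    ring
  have hrow : ∀ j, 1 ≤ j → j < n →
      secantAngle z j n - secantAngle z 0 j = secantAngle z 1 n - secantAngle z 0 1 := by
    intro j hj
    induction j, hj using Nat.le_induction with
    | base => intro _; rfl
    | succ j hj ih =>
      intro h
      rw [← ih (by omega)]
      simpa using hright 0 j (by omega) (by omega)
  -- The difference `c` has the same value at `(0, 1)` and at `(1, n)`, passing through `(0, n - 1)` and
  -- `(1, n - 1)`. The two values add up to the total turning, and `c ≡ 4` modulo `8`.
  have h1 := hrow (n - 1) (by omega) (by omega)
  have h2 := hleft 0 (n - 1) (by omega) (by omega)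
  have h3 := hright 1 (n - 1) (by omega) (by omega)
  rw [show n - 1 + 1 = n by omega] at h3
  have h4 := secantAngle_self_succ z n
  have h5 := secantAngle_self_succ z 0
  have h6 := eight_dvd_secantAngle_sub z (by omega : 1 < n)
  have h7 := eight_dvd_secantAngle_sub z (by omega : 0 < 1)
  have h8 := eight_dvd_sector_neg (hne (by omega : 0 < 1) (by omega))
  have h9 := hneg 0 1
  simp only [zero_add] at *
  rw [← h9] at h8
  rw [add_comm 1 n] at h3
  omega

end Cycle

/-! ### Periodic orbits of the walk -/

section Orbit

variable {u v : ℤ → ℤ} {z : ℕ → ℤ × ℤ} {n : ℕ}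

/-- The turning of the walk is the increment of a function of the position, so it vanishes over a
period. -/
lemma diagonalAngle_sub_eq_zero (hu : ∀ y, u y = 1 ∨ u y = -1) (hv : ∀ x, v x = 1 ∨ v x = -1)
    (hz : ∀ k, z (k + 1) = walkStep u v (z k)) (hne : ∀ k, z k ≠ z (k + 2)) (hn : z n = z 0) :
    diagonalAngle z n - diagonalAngle z 0 = 0 := by
  obtain ⟨G, hG⟩ := exists_antidifference fun x => v x + v (x + 1)
  obtain ⟨H, hH⟩ := exists_antidifference fun y => u y + u (y + 1)
  have key : ∀ k, diagonalAngle z k - diagonalAngle z 0 =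
      (G (z k).1 - H (z k).2) - (G (z 0).1 - H (z 0).2) := by
    intro k
    induction k with
    | zero => ring
    | succ k ih =>
      have e1 := hz k
      have e2 := hz (k + 1)
      have hc := turn_corner (hu (z k).2) (hv (z k).1) (hu (z (k + 1)).2) (hv (z (k + 1)).1)
      have d1 : z (k + 1) - z k = (u (z k).2, v (z k).1) := by
        rw [e1]; ext <;> simp [walkStep]
      have d2 : z (k + 2) - z (k + 1) = (u (z (k + 1)).2, v (z (k + 1)).1) := by
        rw [e2]; ext <;> simp [walkStep]
      have d3 : z (k + 2) - z k = (u (z k).2 + u (z (k + 1)).2, v (z k).1 + v (z (k + 1)).1) := by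
        rw [← sub_add_sub_cancel (z (k + 2)) (z (k + 1)) (z k), d1, d2]
        ext <;> simp [add_comm]
      have hc' := hc fun h => hne k (by rw [h] at d3; exact (sub_eq_zero.1 d3).symm)
      have x1 : (z (k + 1)).1 = (z k).1 + u (z k).2 := by rw [e1, walkStep]
      have y1 : (z (k + 1)).2 = (z k).2 + v (z k).1 := by rw [e1, walkStep]
      have hG' : G (z (k + 1)).1 - G (z k).1 =
          u (z k).2 * (v (z k).1 + v (z (k + 1)).1) := by
        rw [x1]
        rcases hu (z k).2 with h | h <;> rw [h]
        · rw [hG]; ring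
        · have := hG ((z k).1 + -1)
          rw [neg_add_cancel_right] at this
          linarith
      have hH' : H (z (k + 1)).2 - H (z k).2 =
          v (z k).1 * (u (z k).2 + u (z (k + 1)).2) := by
        rw [y1]
        rcases hv (z k).1 with h | h <;> rw [h]
        · rw [hH]; ring
        · have := hH ((z k).2 + -1)
          rw [neg_add_cancel_right] at this
          linarith
      have hd : diagonalAngle z (k + 1) = diagonalAngle z k + turn (z (k + 1) - z k)
          (z (k + 2) - z k) + turn (z (k + 2) - z k) (z (k + 2) - z (k + 1)) := rfl
      rw [d1, d2, d3] at hd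
      linarith
  rw [key, hn, sub_self]

theorem eventuallyStuck_of_finite_range (hu : ∀ y, u y = 1 ∨ u y = -1)
    (hv : ∀ x, v x = 1 ∨ v x = -1)
    (hb : (Set.range (diagonalWalk u v)).Finite) :
    EventuallyStuckOnEdge (diagonalWalk u v) ∧ EventuallyTwoPeriodic (diagonalWalk u v) := by
  set z := diagonalWalk u v with hzdef
  have hz : ∀ k, z (k + 1) = walkStep u v (z k) := fun k => rfl
  have hstep : ∀ k, |(z (k + 1)).1 - (z k).1| = 1 ∧ |(z (k + 1)).2 - (z k).2| = 1 := by
    intro k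
    rw [hz]
    constructor
    · rcases hu (z k).2 with h | h <;> simp [walkStep, h]
    · rcases hv (z k).1 with h | h <;> simp [walkStep, h]
  have hex : ∃ n, 0 < n ∧ ∃ N, z (N + n) = z N := by
    obtain ⟨i, j, hij, h⟩ : ∃ i j, i < j ∧ z i = z j := by
      by_contra! hcon
      have hinj : Function.Injective z := fun i j h => by
        rcases lt_trichotomy i j with h' | h' | h'
        · exact absurd h (hcon i j h')
        · exact h'
        · exact absurd h.symm (hcon j i h')
      exact Set.infinite_range_of_injective hinj hb
    exact ⟨j - i, by omega, i, by rw [h]; congr 1; omega⟩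
  classical
  obtain ⟨n, ⟨hn0, N, hN⟩, hmin⟩ : ∃ n, (0 < n ∧ ∃ N, z (N + n) = z N) ∧
      ∀ m, 0 < m → m < n → ∀ N, z (N + m) ≠ z N :=
    ⟨Nat.find hex, Nat.find_spec hex, fun m h0 h1 N h => Nat.find_min hex h1 ⟨h0, N, h⟩⟩
  have hper : ∀ k, z (N + k + n) = z (N + k) := by
    intro k
    induction k with
    | zero => exact hN
    | succ k ih =>
      rw [show N + (k + 1) + n = N + k + n + 1 by ring, show N + (k + 1) = N + k + 1 by ring, hz,
        hz, ih]
  have hn1 : n ≠ 1 := by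
    rintro rfl
    have := (hstep N).1
    rw [hN] at this
    simp at this
  have hn3 : ¬ 3 ≤ n := by
    intro h3
    have hinj : ∀ i j, i < j → j < i + n → z (N + i) ≠ z (N + j) := by
      intro i j h1 h2 h
      refine hmin (j - i) (by omega) (by omega) (N + i) ?_
      rw [h]; congr 1; omega
    -- The polygon is simple, by minimality of the period.
    refine diagonalAngle_sub_ne_zero (z := fun k => z (N + k)) (n := n) (fun k => hstep (N + k))
      hinj (fun k => by rw [← add_assoc]; exact hper k) h3 ?_
    exact diagonalAngle_sub_eq_zero hu hv (z := fun k => z (N + k)) (fun k => hz (N + k))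
      (fun k => hinj k (k + 2) (by omega) (by omega)) (by simpa using hN)
  obtain rfl : n = 2 := by omega
  have hper' : ∀ k ≥ N, z (k + 2) = z k := by
    intro k hk
    obtain ⟨m, rfl⟩ := Nat.exists_eq_add_of_le hk
    exact hper m
  refine ⟨⟨z N, z (N + 1), ⟨?_, ?_⟩, N, ?_⟩, N, hper'⟩
  · rw [abs_sub_comm]; exact (hstep N).1
  · rw [abs_sub_comm]; exact (hstep N).2
  · intro k hk
    induction k, hk using Nat.le_induction with
    | base => rfl
    | succ k hk ih => rw [← ih, hper' k hk, Sym2.eq_swap]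

end Orbit

/-! ### Fresh columns -/

/-- `n` is the first time at which the walk visits column `M`. The condition is that it was
strictly to the left of `M` before, which is the same for `M ≥ 0`. -/
def IsFirstVisit (u v : ℤ → ℤ) (M : ℤ) (n : ℕ) : Prop :=
  (diagonalWalk u v n).1 = M ∧ ∀ k < n, (diagonalWalk u v k).1 < M

/-- The walk visits column `M`, and on its first visit it arrives on a row that points left. -/
def TurnsBackAt (u v : ℤ → ℤ) (M : ℤ) : Prop :=
  ∃ n, IsFirstVisit u v M n ∧ u (diagonalWalk u v n).2 = -1

section Path

variable {u v : ℤ → ℤ}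

lemma diagonalWalk_succ (u v : ℤ → ℤ) (n : ℕ) :
    diagonalWalk u v (n + 1) = ((diagonalWalk u v n).1 + u (diagonalWalk u v n).2,
      (diagonalWalk u v n).2 + v (diagonalWalk u v n).1) := rfl

lemma exists_isFirstVisit (hu : ∀ y, u y = 1 ∨ u y = -1) {M : ℤ} (hM : 0 ≤ M)
    (h : ∃ k, M ≤ (diagonalWalk u v k).1) : ∃ n, IsFirstVisit u v M n := by
  classical
  refine ⟨Nat.find h, ?_, fun k hk => not_le.1 (Nat.find_min h hk)⟩
  refine le_antisymm ?_ (Nat.find_spec h)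
  rcases hn : Nat.find h with _ | n
  · exact hM
  · have h1 := not_le.1 (Nat.find_min h (m := n) (by omega))
    rw [diagonalWalk_succ]
    have h2 := hu (diagonalWalk u v n).2
    dsimp only
    omega

lemma IsFirstVisit.diagonalWalk_congr {v' : ℤ → ℤ} {M : ℤ} {n : ℕ} (h : IsFirstVisit u v M n)
    (hv : ∀ x, x ≠ M → v x = v' x) {k : ℕ} (hk : k ≤ n) :
    diagonalWalk u v' k = diagonalWalk u v k := by
  induction k with
  | zero => rfl
  | succ k ih =>
    rw [diagonalWalk_succ, diagonalWalk_succ, ih (by omega), hv _ (h.2 k (by omega)).ne]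

/-- The event `TurnsBackAt u v M` does not involve the orientation of column `M`. -/
lemma TurnsBackAt.congr {v' : ℤ → ℤ} {M : ℤ} (hv : ∀ x, x ≠ M → v x = v' x)
    (h : TurnsBackAt u v M) : TurnsBackAt u v' M := by
  obtain ⟨n, hn, hun⟩ := h
  refine ⟨n, ⟨?_, fun k hk => ?_⟩, ?_⟩
  · rw [hn.diagonalWalk_congr hv le_rfl]; exact hn.1
  · rw [hn.diagonalWalk_congr hv hk.le]; exact hn.2 k hk
  · rw [hn.diagonalWalk_congr hv le_rfl]; exact hun

/-- If the walk turns back on its first visit to column `M` and the columns `M - 1` and `M` have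
opposite orientations, then it returns to where it came from, and stays on that edge. -/
lemma TurnsBackAt.fst_le (hu : ∀ y, u y = 1 ∨ u y = -1) {M : ℤ} (hM : 0 < M)
    (h : TurnsBackAt u v M) (hv : v M = -v (M - 1)) (k : ℕ) : (diagonalWalk u v k).1 ≤ M := by
  obtain ⟨n, ⟨h1, h2⟩, h3⟩ := h
  obtain _ | m := n
  · exact absurd h1 hM.ne
  have hm := h2 m (by omega)
  obtain ⟨hx, hum⟩ : (diagonalWalk u v m).1 = M - 1 ∧ u (diagonalWalk u v m).2 = 1 := by
    have := hu (diagonalWalk u v m).2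
    rw [diagonalWalk_succ] at h1
    dsimp only at h1
    omega
  have hback : diagonalWalk u v (m + 2) = diagonalWalk u v m := by
    have e := diagonalWalk_succ u v (m + 1)
    rw [h1, h3, hv] at e
    rw [show m + 2 = m + 1 + 1 from rfl, e, diagonalWalk_succ]
    dsimp only
    ext
    · dsimp only; rw [hx]; ring
    · dsimp only; rw [hx]; ring
  have key : ∀ j, diagonalWalk u v (m + j + 2) = diagonalWalk u v (m + j) := by
    intro j
    induction j with
    | zero => exact hback
    | succ j ih =>
      rw [show m + (j + 1) + 2 = (m + j + 2) + 1 by ring, diagonalWalk_succ, ih]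
      rfl
  have hbound : ∀ j, (diagonalWalk u v (m + j)).1 ≤ M ∧ (diagonalWalk u v (m + j + 1)).1 ≤ M := by
    intro j
    induction j with
    | zero => exact ⟨hm.le, h1.le⟩
    | succ j ih =>
      refine ⟨ih.2, ?_⟩
      have := key j
      rw [show m + (j + 1) + 1 = m + j + 2 by ring, this]
      exact ih.1
  rcases lt_or_ge k m with hk | hk
  · exact (h2 k (by omega)).le
  · obtain ⟨j, rfl⟩ := Nat.exists_eq_add_of_le hk
    exact (hbound j).1

/-- If the walk turns back at finitely many fresh columns only, the columns contain arbitrarily long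
runs of `1`, and there are rows pointing left arbitrarily far up and down, then the abscissa is
bounded above. -/
lemma exists_fst_le_of_eventually_not_turnsBackAt (hu : ∀ y, u y = 1 ∨ u y = -1)
    (hv : ∀ x, v x = 1 ∨ v x = -1)
    (hturn : ∀ᶠ M : ℕ in Filter.atTop, ¬ TurnsBackAt u v M)
    (hrun : ∀ L N : ℕ, ∃ m ≥ N, ∀ j < L, v ((m + j : ℕ) : ℤ) = 1)
    (hup : ∀ N : ℕ, ∃ m : ℕ, m ≥ N ∧ u m = -1)
    (hdown : ∀ N : ℕ, ∃ m : ℕ, m ≥ N ∧ u (-m) = -1) :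
    ∃ B, ∀ k, (diagonalWalk u v k).1 ≤ B := by
  by_contra! hub
  obtain ⟨M, hM⟩ := Filter.eventually_atTop.1 hturn
  obtain ⟨n, hn⟩ := exists_isFirstVisit (v := v) hu (M := (M : ℤ)) (by omega)
    ((hub M).imp fun _ => le_of_lt)
  have hone : ∀ {k : ℕ}, IsFirstVisit u v ((M + k : ℕ) : ℤ) (n + k) →
      u (diagonalWalk u v (n + k)).2 = 1 := fun {k} hk =>
    (hu _).resolve_right fun h => hM (M + k) (by omega) ⟨_, hk, h⟩
  -- From time `n` on, the walk enters a fresh column at each step.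
  have hvisit : ∀ k : ℕ, IsFirstVisit u v ((M + k : ℕ) : ℤ) (n + k) := by
    intro k
    induction k with
    | zero => exact hn
    | succ k ih =>
      have h1 := hone ih
      refine ⟨?_, fun i hi => ?_⟩
      · rw [← add_assoc, diagonalWalk_succ, h1, ih.1]; push_cast; ring
      · rcases (show i < n + k ∨ i = n + k by omega) with h | rfl
        · have := ih.2 i h
          push_cast at *; omega
        · rw [ih.1]; push_cast; omega
  have hY : ∀ k : ℕ, (diagonalWalk u v (n + k + 1)).2 =
      (diagonalWalk u v (n + k)).2 + v ((M + k : ℕ) : ℤ) := fun k => by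
    rw [diagonalWalk_succ, (hvisit k).1]
  obtain ⟨a, ha, hua⟩ := hup ((diagonalWalk u v n).2.toNat + 1)
  obtain ⟨b, hb, hub'⟩ := hdown ((-(diagonalWalk u v n).2).toNat + 1)
  -- The ordinate moves by unit steps and cannot hit the rows `a` and `-b`, which point left.
  have hconf : ∀ k : ℕ, -(b : ℤ) < (diagonalWalk u v (n + k)).2 ∧
      (diagonalWalk u v (n + k)).2 < a := by
    intro k
    induction k with
    | zero => rw [add_zero]; omega
    | succ k ih =>
      have h1 := hone (hvisit (k + 1))
      have h2 := hv ((M + k : ℕ) : ℤ)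
      have h3 := hY k
      have h4 : (diagonalWalk u v (n + (k + 1))).2 ≠ a := fun h => by rw [h] at h1; omega
      have h5 : (diagonalWalk u v (n + (k + 1))).2 ≠ -b := fun h => by rw [h] at h1; omega
      rw [← add_assoc] at *
      omega
  obtain ⟨m, hm, hrun⟩ := hrun (a + b) M
  obtain ⟨i, rfl⟩ := Nat.exists_eq_add_of_le hm
  -- Along a run of `a + b` columns pointing up, the ordinate would leave the strip.
  have hclimb : ∀ j ≤ a + b, (diagonalWalk u v (n + (i + j))).2 =
      (diagonalWalk u v (n + i)).2 + j := by
    intro j hj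
    induction j with
    | zero => simp
    | succ j ih =>
      have h1 := hY (i + j)
      have h2 := hrun j (by omega)
      rw [show M + (i + j) = M + i + j by ring, h2, ih (by omega)] at h1
      rw [show n + (i + (j + 1)) = n + (i + j) + 1 by ring, h1]
      push_cast; ring
  have h1 := hconf i
  have h2 := hconf (i + (a + b))
  rw [hclimb _ le_rfl] at h2
  push_cast at h2
  omega

end Path

/-! ### Runs of fair coins -/

section Runs

variable {Ω : Type*} [MeasurableSpace Ω] {P : Measure Ω} [IsProbabilityMeasure P]

/-- A sequence of independent fair coins contains arbitrarily long runs of `1` arbitrarily far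
out. -/
lemma ae_exists_run {ξ : ℕ → Ω → ℤ} (hm : ∀ n, Measurable (ξ n))
    (hp : ∀ n, P {ω | ξ n ω = 1} = 2⁻¹) (hind : iIndepFun ξ P) :
    ∀ᵐ ω ∂P, ∀ L N : ℕ, ∃ m ≥ N, ∀ j < L, ξ (m + j) ω = 1 := by
  rw [ae_all_iff]
  intro L
  rcases Nat.eq_zero_or_pos L with rfl | hL
  · exact ae_of_all _ fun ω N => ⟨N, le_rfl, by simp⟩
  -- Second Borel-Cantelli lemma for the disjoint blocks `[L * k, L * k + L)`.
  let g : ℕ × Fin L → ℕ := fun p => L * p.1 + p.2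
  have hg : Function.Injective g := by
    rintro ⟨a, i⟩ ⟨b, j⟩ h
    have hi := i.2
    have hj := j.2
    simp only [g] at h
    have e1 : (L * a + i) / L = a := by
      rw [Nat.mul_add_div hL, Nat.div_eq_of_lt hi, add_zero]
    have e2 : (L * b + j) / L = b := by
      rw [Nat.mul_add_div hL, Nat.div_eq_of_lt hj, add_zero]
    rw [h, e2] at e1
    subst e1
    ext <;> simp at h ⊢
    exact h
  have hind' := hind.precomp hg
  set E : ℕ → Set Ω := fun k => ⋂ j : Fin L, ξ (g (k, j)) ⁻¹' {1} with hE
  have hEm : ∀ k, MeasurableSet (E k) := fun k =>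
    MeasurableSet.iInter fun j => hm _ (measurableSet_singleton 1)
  have hprod : ∀ s : Finset ℕ, P (⋂ k ∈ s, E k) = ∏ _k ∈ s, (2⁻¹ : ENNReal) ^ L := by
    intro s
    have h1 : (⋂ k ∈ s, E k) = ⋂ p ∈ s ×ˢ (Finset.univ : Finset (Fin L)), ξ (g p) ⁻¹' {1} := by
      ext ω; simp only [hE, Set.mem_iInter, Finset.mem_product, Finset.mem_univ, and_true,
        Prod.forall]
      exact ⟨fun H a b ha => H a ha b, fun H a ha b => H a b ha⟩
    rw [h1, hind'.measure_inter_preimage_eq_mul (s ×ˢ Finset.univ) (sets := fun _ => {1})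
      (fun _ _ => measurableSet_singleton 1), Finset.prod_product]
    have h2 : ∀ i, P (ξ i ⁻¹' {1}) = 2⁻¹ := hp
    simp [h2]
  have hPE : ∀ k, P (E k) = (2⁻¹ : ENNReal) ^ L := fun k => by simpa using hprod {k}
  have hEind : iIndepSet E P := by
    rw [iIndepSet_iff_meas_biInter hEm]
    intro s
    rw [hprod]
    simp [hPE]
  have hsum : ∑' k, P (E k) = ⊤ := by
    simp_rw [hPE]
    exact ENNReal.tsum_const_eq_top_of_ne_zero (by simp)
  have hlim := measure_limsup_eq_one hEm hEind hsum
  have hae : ∀ᵐ ω ∂P, ω ∈ Filter.limsup E Filter.atTop :=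
    (prob_compl_eq_zero_iff (MeasurableSet.measurableSet_limsup hEm)).2 hlim
  filter_upwards [hae] with ω hω N
  rw [Filter.mem_limsup_iff_frequently_mem] at hω
  obtain ⟨k, hk, hkE⟩ := Filter.frequently_atTop.1 hω N
  refine ⟨L * k, by nlinarith, fun j hj => ?_⟩
  simpa [hE, g] using Set.mem_iInter.1 hkE ⟨j, hj⟩

end Runs

/-! ### The random environment -/

/-- The rows `U y` and the columns `V x` are oriented by independent fair coins with values `±1`. -/
structure IsFairEnvironment {Ω : Type*} [MeasurableSpace Ω] (P : Measure Ω) (U V : ℤ → Ω → ℤ) :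
    Prop where
  measurable_row : ∀ y, Measurable (U y)
  measurable_col : ∀ x, Measurable (V x)
  row_eq : ∀ y ω, U y ω = 1 ∨ U y ω = -1
  col_eq : ∀ x ω, V x ω = 1 ∨ V x ω = -1
  row_symm : ∀ y, P {ω | U y ω = 1} = P {ω | U y ω = -1}
  col_symm : ∀ x, P {ω | V x ω = 1} = P {ω | V x ω = -1}
  indep : iIndepFun (Sum.elim U V : ℤ ⊕ ℤ → Ω → ℤ) P

lemma measure_eq_half {Ω : Type*} [MeasurableSpace Ω] {P : Measure Ω} [IsProbabilityMeasure P]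
    {X : Ω → ℤ} (hX : Measurable X) (hval : ∀ ω, X ω = 1 ∨ X ω = -1)
    (hsymm : P {ω | X ω = 1} = P {ω | X ω = -1}) : P {ω | X ω = 1} = 2⁻¹ := by
  have h1 : P ({ω | X ω = 1} ∪ {ω | X ω = -1}) = P {ω | X ω = 1} + P {ω | X ω = -1} :=
    measure_union (Set.disjoint_left.2 fun ω h h' => by
      simp only [Set.mem_ofPred_eq] at h h'; omega) (hX (measurableSet_singleton (-1)))
  have h2 : ({ω | X ω = 1} ∪ {ω | X ω = -1}) = Set.univ := by
    ext ω; simpa using hval ω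
  rw [h2, measure_univ, ← hsymm, ← two_mul] at h1
  exact ENNReal.eq_inv_of_mul_eq_one_left (by rw [mul_comm]; exact h1.symm)

lemma measurable_diagonalWalk {Ω : Type*} [MeasurableSpace Ω] {U V : ℤ → Ω → ℤ}
    (hU : ∀ y, Measurable (U y)) (hV : ∀ x, Measurable (V x)) (n : ℕ) :
    Measurable fun ω => diagonalWalk (fun y => U y ω) (fun x => V x ω) n := by
  induction n with
  | zero => exact measurable_const
  | succ n ih =>
    have hU' : Measurable fun p : Ω × ℤ => U p.2 p.1 := measurable_from_prod_countable_left hU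
    have hV' : Measurable fun p : Ω × ℤ => V p.2 p.1 := measurable_from_prod_countable_left hV
    exact (ih.fst.add (hU'.comp (measurable_id.prodMk ih.snd))).prodMk
      (ih.snd.add (hV'.comp (measurable_id.prodMk ih.fst)))

lemma measurableSet_turnsBackAt {Ω : Type*} [MeasurableSpace Ω] {U V : ℤ → Ω → ℤ}
    (hU : ∀ y, Measurable (U y)) (hV : ∀ x, Measurable (V x)) (M : ℤ) :
    MeasurableSet {ω | TurnsBackAt (fun y => U y ω) (fun x => V x ω) M} := by
  have hw := measurable_diagonalWalk hU hV
  have hU' : Measurable fun p : Ω × ℤ => U p.2 p.1 := measurable_from_prod_countable_left hU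
  simp only [TurnsBackAt, IsFirstVisit, Set.ofPred_exists, Set.ofPred_and, Set.ofPred_forall]
  refine MeasurableSet.iUnion fun n => ((?_ : MeasurableSet _).inter ?_).inter ?_
  · exact (hw n).fst (measurableSet_singleton M)
  · exact MeasurableSet.iInter fun k => MeasurableSet.iInter fun _ =>
      (hw k).fst measurableSet_Iio
  · exact (hU'.comp (measurable_id.prodMk (hw n).snd)) (measurableSet_singleton (-1))

namespace IsFairEnvironment

variable {Ω : Type*} [MeasurableSpace Ω] {P : Measure Ω} {U V : ℤ → Ω → ℤ}

/-- Exchange of the two coordinate axes. -/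
lemma swap (h : IsFairEnvironment P U V) : IsFairEnvironment P V U where
  measurable_row := h.measurable_col
  measurable_col := h.measurable_row
  row_eq := h.col_eq
  col_eq := h.row_eq
  row_symm := h.col_symm
  col_symm := h.row_symm
  indep := by
    have := h.indep.precomp (Equiv.sumComm ℤ ℤ).injective
    convert this using 1
    funext i
    cases i <;> rfl

/-- Reflection in the vertical axis: it reverses the rows and permutes the columns. -/
lemma reflect (h : IsFairEnvironment P U V) :
    IsFairEnvironment P (fun y ω => -U y ω) (fun x => V (-x)) where
  measurable_row y := (h.measurable_row y).neg
  measurable_col x := h.measurable_col (-x)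
  row_eq y ω := by have := h.row_eq y ω; omega
  col_eq x := h.col_eq (-x)
  row_symm y := by
    have := h.row_symm y
    simp only [neg_eq_iff_eq_neg]
    exact this.symm
  col_symm x := h.col_symm (-x)
  indep := by
    have h1 := h.indep.precomp (g := Sum.map id Neg.neg)
      (Function.Injective.sumMap Function.injective_id neg_injective)
    have h2 := h1.comp (γ := fun _ => ℤ) (Sum.elim (fun _ : ℤ => Neg.neg) fun _ : ℤ => id)
      (fun i => measurable_of_countable _)
    convert h2 using 1
    funext i
    cases i <;> rfl

variable [IsProbabilityMeasure P]

lemma measure_col (h : IsFairEnvironment P U V) (x : ℤ) {s : ℤ} (hs : s = 1 ∨ s = -1) :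
    P {ω | V x ω = s} = 2⁻¹ := by
  have := measure_eq_half (h.measurable_col x) (h.col_eq x) (h.col_symm x)
  rcases hs with rfl | rfl
  · exact this
  · rw [← h.col_symm, this]

/-- The orientation of column `M` is independent of the path up to its first visit to that
column, and of the orientation of column `M - 1`. -/
lemma measure_turnsBackAt_inter (h : IsFairEnvironment P U V) (M : ℤ) {s t : ℤ}
    (ht : t = 1 ∨ t = -1) :
    P ({ω | TurnsBackAt (fun y => U y ω) (fun x => V x ω) M ∧ V (M - 1) ω = s} ∩
        {ω | V M ω = t}) =
      P {ω | TurnsBackAt (fun y => U y ω) (fun x => V x ω) M ∧ V (M - 1) ω = s} * 2⁻¹ := by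
  set F : ℤ ⊕ ℤ → Ω → ℤ := Sum.elim U V with hF
  have hFm : ∀ i, Measurable (F i) := by
    rintro (y | x)
    · exact h.measurable_row y
    · exact h.measurable_col x
  have hle : ∀ i, MeasurableSpace.comap (F i) inferInstance ≤ (inferInstance : MeasurableSpace Ω) :=
    fun i => (hFm i).comap_le
  have hind := indep_iSup_of_disjoint hle h.indep.iIndep
    (S := {Sum.inr M}ᶜ) (T := {Sum.inr M}) disjoint_compl_left
  rw [Indep_iff] at hind
  rw [← h.measure_col M ht]
  refine hind _ _ ?_ ?_
  · set m' : MeasurableSpace Ω :=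
      ⨆ i ∈ ({Sum.inr M}ᶜ : Set (ℤ ⊕ ℤ)), MeasurableSpace.comap (F i) inferInstance with hm'
    have hmeas : ∀ i, i ≠ Sum.inr M → Measurable[m'] (F i) := fun i hi =>
      Measurable.mono (comap_measurable (F i))
        (le_iSup₂_of_le (f := fun i (_ : i ∈ ({Sum.inr M}ᶜ : Set (ℤ ⊕ ℤ))) =>
          MeasurableSpace.comap (F i) inferInstance) i hi le_rfl) le_rfl
    have hU' : ∀ y, Measurable[m'] (U y) := fun y => hmeas (Sum.inl y) (by simp)
    have hV' : ∀ x, Measurable[m'] (Function.update V M (fun _ => 1) x) := by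
      intro x
      rcases eq_or_ne x M with rfl | hx
      · rw [Function.update_self]; exact @measurable_const _ _ _ m' _
      · rw [Function.update_of_ne hx]; exact hmeas (Sum.inr x) (by simpa using hx)
    -- Overwriting `V M` by a constant exhibits the event as one that does not depend on `V M`.
    have hset : {ω | TurnsBackAt (fun y => U y ω) (fun x => V x ω) M ∧ V (M - 1) ω = s} =
        {ω | TurnsBackAt (fun y => U y ω)
          (fun x => Function.update V M (fun _ => 1) x ω) M} ∩ V (M - 1) ⁻¹' {s} := by
      ext ω
      have hagree : ∀ x, x ≠ M → V x ω = Function.update V M (fun _ => 1) x ω := fun x hx => by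
        rw [Function.update_of_ne hx]
      exact and_congr_left fun _ => ⟨fun hT => hT.congr hagree,
        fun hT => hT.congr fun x hx => (hagree x hx).symm⟩
    rw [hset]
    exact @MeasurableSet.inter _ m' _ _ (@measurableSet_turnsBackAt _ m' _ _ hU' hV' M)
      (hmeas (Sum.inr (M - 1)) (by simp) (measurableSet_singleton s))
  · have : MeasurableSpace.comap (F (Sum.inr M)) inferInstance ≤
        ⨆ i ∈ ({Sum.inr M} : Set (ℤ ⊕ ℤ)), MeasurableSpace.comap (F i) inferInstance := by
      simp
    exact this _ ⟨{t}, measurableSet_singleton t, rfl⟩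

lemma measure_turnsBackAt_le (h : IsFairEnvironment P U V) (M : ℤ) :
    P {ω | TurnsBackAt (fun y => U y ω) (fun x => V x ω) M} ≤
      2 * P {ω | TurnsBackAt (fun y => U y ω) (fun x => V x ω) M ∧ V M ω = -V (M - 1) ω} := by
  set A : ℤ → Set Ω := fun s =>
    {ω | TurnsBackAt (fun y => U y ω) (fun x => V x ω) M ∧ V (M - 1) ω = s} with hA
  have hhalf : ∀ s t : ℤ, (t = 1 ∨ t = -1) → P (A s) = 2 * P (A s ∩ {ω | V M ω = t}) := by
    intro s t ht
    rw [h.measure_turnsBackAt_inter M ht, mul_comm, mul_assoc,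
      ENNReal.inv_mul_cancel (by simp) (by simp), mul_one]
  have hmeas : MeasurableSet (A (-1) ∩ {ω | V M ω = 1}) :=
    ((measurableSet_turnsBackAt h.measurable_row h.measurable_col M).inter
      (h.measurable_col (M - 1) (measurableSet_singleton (-1)))).inter
      (h.measurable_col M (measurableSet_singleton 1))
  calc P {ω | TurnsBackAt (fun y => U y ω) (fun x => V x ω) M}
      ≤ P (A 1 ∪ A (-1)) := measure_mono fun ω hω =>
        (h.col_eq (M - 1) ω).imp (fun h' => ⟨hω, h'⟩) (fun h' => ⟨hω, h'⟩)
    _ ≤ P (A 1) + P (A (-1)) := measure_union_le _ _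
    _ = 2 * P (A 1 ∩ {ω | V M ω = -1} ∪ A (-1) ∩ {ω | V M ω = 1}) := by
        rw [hhalf 1 (-1) (by simp), hhalf (-1) 1 (by simp), ← mul_add, measure_union _ hmeas]
        refine Set.disjoint_left.2 fun ω h1 h2 => ?_
        have h3 := h1.1.2
        have h4 := h2.1.2
        omega
    _ ≤ _ := by
        gcongr
        rintro ω (⟨⟨h1, h2⟩, h3⟩ | ⟨⟨h1, h2⟩, h3⟩)
        · exact ⟨h1, by rw [h2]; exact h3⟩
        · exact ⟨h1, by rw [h2, neg_neg]; exact h3⟩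

lemma ae_eventually_not_turnsBackAt (h : IsFairEnvironment P U V) :
    ∀ᵐ ω ∂P, ∀ᶠ M : ℕ in Filter.atTop, ¬ TurnsBackAt (fun y => U y ω) (fun x => V x ω) M := by
  -- Columns `M + 1` are considered, as column `0` is not entered from the left.
  set A : ℕ → Set Ω := fun M =>
    {ω | TurnsBackAt (fun y => U y ω) (fun x => V x ω) ((M + 1 : ℕ) : ℤ)} with hA
  set B : ℕ → Set Ω := fun M => {ω | TurnsBackAt (fun y => U y ω) (fun x => V x ω) ((M + 1 : ℕ) : ℤ)
    ∧ V ((M + 1 : ℕ) : ℤ) ω = -V (((M + 1 : ℕ) : ℤ) - 1) ω} with hB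
  have hBm : ∀ M, MeasurableSet (B M) := fun M =>
    (measurableSet_turnsBackAt h.measurable_row h.measurable_col _).inter
      (measurableSet_eq_fun (h.measurable_col _) (h.measurable_col _).neg)
  -- On `B M` the walk never goes beyond column `M + 1`.
  have hdisj : Pairwise (Function.onFun Disjoint B) := by
    rw [pairwise_disjoint_on]
    intro M M' hlt
    refine Set.disjoint_left.2 fun ω h1 h2 => ?_
    obtain ⟨n, hn, -⟩ := h2.1
    have := h1.1.fst_le (fun y => h.row_eq y ω) (by omega) h1.2 n
    rw [hn.1] at this
    omega
  have hsum : ∑' M, P (A M) ≠ ⊤ := by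
    refine ne_top_of_le_ne_top (b := 2) (by simp) ?_
    calc ∑' M, P (A M) ≤ ∑' M, 2 * P (B M) :=
          ENNReal.tsum_le_tsum fun M => h.measure_turnsBackAt_le _
      _ = 2 * P (⋃ M, B M) := by rw [ENNReal.tsum_mul_left, measure_iUnion hdisj hBm]
      _ ≤ 2 * 1 := by gcongr; exact prob_le_one
      _ = 2 := mul_one 2
  filter_upwards [ae_eventually_notMem hsum] with ω hω
  rw [← Filter.map_add_atTop_eq_nat 1]
  exact hω

lemma ae_exists_col_run (h : IsFairEnvironment P U V) :
    ∀ᵐ ω ∂P, ∀ L N : ℕ, ∃ m ≥ N, ∀ j < L, V ((m + j : ℕ) : ℤ) ω = 1 :=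
  ae_exists_run (ξ := fun n : ℕ => V n) (fun n => h.measurable_col n)
    (fun n => h.measure_col n (Or.inl rfl))
    (h.indep.precomp (g := fun n : ℕ => Sum.inr (n : ℤ))
      (Sum.inr_injective.comp Nat.cast_injective))

lemma ae_exists_row_eq_neg_one (h : IsFairEnvironment P U V) :
    ∀ᵐ ω ∂P, ∀ N : ℕ, ∃ m : ℕ, m ≥ N ∧ U m ω = -1 := by
  filter_upwards [h.reflect.swap.ae_exists_col_run] with ω hω N
  obtain ⟨m, hm, hrun⟩ := hω 1 N
  have := hrun 0 one_pos
  exact ⟨m, hm, by simpa [neg_eq_iff_eq_neg] using this⟩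

lemma ae_exists_fst_le (h : IsFairEnvironment P U V) :
    ∀ᵐ ω ∂P, ∃ B, ∀ k, (diagonalWalk (fun y => U y ω) (fun x => V x ω) k).1 ≤ B := by
  filter_upwards [h.ae_eventually_not_turnsBackAt, h.ae_exists_col_run,
    h.ae_exists_row_eq_neg_one, h.swap.reflect.swap.ae_exists_row_eq_neg_one] with ω h1 h2 h3 h4
  exact exists_fst_le_of_eventually_not_turnsBackAt (fun y => h.row_eq y ω)
    (fun x => h.col_eq x ω) h1 h2 h3 h4

end IsFairEnvironment

/-! ### Boundedness of the walk -/

lemma diagonalWalk_swap (u v : ℤ → ℤ) (n : ℕ) :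
    diagonalWalk v u n = (diagonalWalk u v n).swap := by
  induction n with
  | zero => rfl
  | succ n ih => rw [diagonalWalk_succ, ih]; rfl

lemma diagonalWalk_reflect (u v : ℤ → ℤ) (n : ℕ) :
    diagonalWalk (fun y => -u y) (fun x => v (-x)) n =
      (-(diagonalWalk u v n).1, (diagonalWalk u v n).2) := by
  induction n with
  | zero => rfl
  | succ n ih =>
    rw [diagonalWalk_succ, ih, diagonalWalk_succ]
    ext
    · dsimp only; ring
    · simp

namespace IsFairEnvironment

variable {Ω : Type*} [MeasurableSpace Ω] {P : Measure Ω} [IsProbabilityMeasure P]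
  {U V : ℤ → Ω → ℤ}

lemma ae_exists_abs_fst_le (h : IsFairEnvironment P U V) :
    ∀ᵐ ω ∂P, ∃ B, ∀ k, |(diagonalWalk (fun y => U y ω) (fun x => V x ω) k).1| ≤ B := by
  filter_upwards [h.ae_exists_fst_le, h.reflect.ae_exists_fst_le] with ω ⟨B, hB⟩ ⟨C, hC⟩
  refine ⟨max B C, fun k => abs_le'.2 ⟨(hB k).trans (le_max_left _ _), ?_⟩⟩
  have := hC k
  rw [diagonalWalk_reflect (fun y => U y ω) (fun x => V x ω)] at this
  exact this.trans (le_max_right _ _)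

lemma ae_finite_range (h : IsFairEnvironment P U V) :
    ∀ᵐ ω ∂P, (Set.range (diagonalWalk (fun y => U y ω) (fun x => V x ω))).Finite := by
  filter_upwards [h.ae_exists_abs_fst_le, h.swap.ae_exists_abs_fst_le] with ω ⟨B, hB⟩ ⟨C, hC⟩
  refine ((Set.finite_Icc (-B) B).prod (Set.finite_Icc (-C) C)).subset ?_
  rintro _ ⟨k, rfl⟩
  have h2 := hC k
  rw [diagonalWalk_swap (fun y => U y ω) (fun x => V x ω)] at h2
  exact ⟨abs_le.1 (hB k), abs_le.1 h2⟩

end IsFairEnvironment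

theorem theorem1 {Ω : Type*} [MeasurableSpace Ω] (P : Measure Ω) [IsProbabilityMeasure P]
    (U V : ℤ → Ω → ℤ)
    (hUmeas : ∀ y, Measurable (U y)) (hVmeas : ∀ x, Measurable (V x))
    (hUval : ∀ y ω, U y ω = 1 ∨ U y ω = -1) (hVval : ∀ x ω, V x ω = 1 ∨ V x ω = -1)
    (hUsymm : ∀ y, P {ω | U y ω = 1} = P {ω | U y ω = -1})
    (hVsymm : ∀ x, P {ω | V x ω = 1} = P {ω | V x ω = -1})
    (hindep : iIndepFun (Sum.elim U V : ℤ ⊕ ℤ → Ω → ℤ) P) :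
    ∀ᵐ ω ∂P,
      EventuallyStuckOnEdge (diagonalWalk (fun y => U y ω) (fun x => V x ω)) ∧
        EventuallyTwoPeriodic (diagonalWalk (fun y => U y ω) (fun x => V x ω)) := by
  have h : IsFairEnvironment P U V := ⟨hUmeas, hVmeas, hUval, hVval, hUsymm, hVsymm, hindep⟩
  filter_upwards [h.ae_finite_range] with ω hω
  exact eventuallyStuck_of_finite_range (fun y => hUval y ω) (fun x => hVval x ω) hω
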